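/- Let $\mathcal X\subset\mathbb R$ be an interval and let $(F_x)_{x\in\mathcal X}$ be distribution functions on $\mathbb R$ such that $x\mapsto F_x(y)$ is non-increasing on $\mathcal X$ for every $y\in\mathbb R$. For a distribution function $G$ and $\beta\in(0,1)$ put $G^{-1}(\beta)=\min\{y: G(y)\ge\beta\}$ and $G^{-1}(\beta+)=\inf\{y: G(y)>\beta\}$; a $\beta$-quantile of $G$ is any number in $[G^{-1}(\beta),G^{-1}(\beta+)]$. For $x\in\mathcal X$ let $Q_x(\beta)$ be any $\beta$-quantile of $F_x$. For each $n\ge2$ let $(X_{n1},Y_{n1}),\dots,(X_{nn},Y_{nn})$ be observations with $X_{ni}\in\mathcal X$ such that, conditional on $\boldsymbol X_n=(X_{ni})_{i=1}^n$, the variables $Y_{n1},\dots,Y_{nn}$ are independent with $\mathbb P(Y_{ni}\le y\mid\boldsymbol X_n)=F_{X_{ni}}(y)$ for all $y\in\mathbb R$. Plug-in estimators. Let $x_1<\dots<x_m$ be the different values among the $X_{ni}$, $w_j=\#\{i:X_{ni}=x_j\}$ and $\widehat{\mathbb F}_j(y)=w_j^{-1}\#\{i: X_{ni}=x_j,\,Y_{ni}\le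 y\}$. For each $y$ let $(\widehat F_{nx_j}(y))_{j=1}^m$ be the unique minimizer of $\sum_{j=1}^m w_j(\widehat{\mathbb F}_j(y)-f_j)^2$ over all $f\in\mathbb R^m$ with $f_1\ge\dots\ge f_m$; each $\widehat F_{nx_j}$ is a distribution function. A plug-in estimator of $(Q_x)_{x\in\mathcal X}$ is any family $(\widehat Q_{nx})_{x\in\mathcal X}$ of functions on $(0,1)$ such that, for each $\beta\in(0,1)$, $x\mapsto\widehat Q_{nx}(\beta)$ is non-decreasing on $\mathcal X$ and $\widehat F_{nx_j}^{-1}(\beta)\le\widehat Q_{nx_j}(\beta)\le\widehat F_{nx_j}^{-1}(\beta+)$ for $1\le j\le m$. Let $\rho_n=\log(n)/n$, let $I\subset\mathcal X$ be an interval, and let $\alpha\in(0,1]$, $C_1,C_2,C_3,\kappa>0$ and $0\le\beta_1<\beta_2\le1$. Put $\delta_n=C_3\rho_n^{1/(2\alpha+1)}$ and $I_n=\{x\in\mathbb R:[x-\delta_n,x+\delta_n]\subset I\}$, and let $\lambda$ denote Lebesgue measure. Assume: (A.1) $\sup_{y\in\mathbb R}|F_w(y)-F_x(y)|\le C_1|w-x|^\alpha$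 for all $w,x\in I$. (A.2) With probability tending to $1$ as $n\to\infty$, every interval $T\subset I$ with $\lambda(T)\ge\delta_n$ satisfies $\#\{i\le n:X_{ni}\in T\}\ge C_2\,n\,\lambda(T)$. (A.3) $F_x(y_2)-F_x(y_1)\ge\kappa(y_2-y_1)$ for all $x\in I$ and $y_1<y_2$ with $F_x(y_1),F_x(y_2-)\in(\beta_1,\beta_2)$. Then there is a constant $C=C(C_1,C_2,C_3)>0$, depending only on $C_1,C_2,C_3$, such that for any plug-in estimator $(\widehat Q_{nx})_{x\in\mathcal X}$ of $(Q_x)_{x\in\mathcal X}$, $$\lim_{n\to\infty}\mathbb P\Bigl(\sup_{x\in I_n,\ \beta\in B_n}\bigl|\widehat Q_{nx}(\beta)-Q_x(\beta)\bigr|>\kappa^{-1}C\rho_n^{\alpha/(2\alpha+1)}\Bigr)=0,$$ where $B_n=(\beta_1+C\rho_n^{\alpha/(2\alpha+1)},\ \beta_2-C\rho_n^{\alpha/(2\alpha+1)})$. -/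

import Mathlib

open MeasureTheory ProbabilityTheory Filter Topology Set

noncomputable section

/-- Distribution functions on the real line. -/
structure IsDistributionFunction (F : ℝ → ℝ) : Prop where
  mono : Monotone F
  right_cont : ∀ y, ContinuousWithinAt F (Ici y) y
  tendsto_atBot : Tendsto F atBot (𝓝 0)
  tendsto_atTop : Tendsto F atTop (𝓝 1)

/-- The minimal `β`-quantile `F⁻¹(β) = min {y | F y ≥ β}`. -/
def minQuantile (F : ℝ → ℝ) (β : ℝ) : ℝ := sInf {y | β ≤ F y}

/-- The maximal `β`-quantile `F⁻¹(β+) = inf {y | F y > β}`. -/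
def maxQuantile (F : ℝ → ℝ) (β : ℝ) : ℝ := sInf {y | β < F y}

/-- `q` is a `β`-quantile of the distribution function `F`. -/
def IsQuantile (F : ℝ → ℝ) (β q : ℝ) : Prop :=
  minQuantile F β ≤ q ∧ q ≤ maxQuantile F β

/-! ### The estimators, for fixed data `(X i, Y i)` -/

/-- The set `{x₁ < ⋯ < xₘ}` of different design points. -/
def designPoints {n : ℕ} (X : Fin n → ℝ) : Finset ℝ := Finset.univ.image X

open Classical in
/-- The number of indices `i` with `X i ∈ B`. -/
def designCount {n : ℕ} (X : Fin n → ℝ) (B : Set ℝ) : ℕ :=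
  (Finset.univ.filter fun i => X i ∈ B).card

/-- The empirical distribution function of those `Y i` for which `X i = x`. -/
def empiricalCDF {n : ℕ} (X Y : Fin n → ℝ) (x y : ℝ) : ℝ :=
  ((Finset.univ.filter fun i => X i = x ∧ Y i ≤ y).card : ℝ) / (designCount X {x} : ℝ)

/-- The weighted least squares criterion `∑ⱼ wⱼ (𝔽̂ⱼ(y) - fⱼ)²`. -/
def lsCriterion {n : ℕ} (X Y : Fin n → ℝ) (y : ℝ) (f : ℝ → ℝ) : ℝ :=
  ∑ x ∈ designPoints X, (designCount X {x} : ℝ) * (empiricalCDF X Y x y - f x) ^ 2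

/-- The values of `f` on the design points are the antitonic least squares estimator of the
values `F_x(y)`, i.e. the minimizer of the least squares criterion among all antitonic vectors.
(Only the values of `f` on the design points matter, and these are unique.) -/
def IsAntitonicLSE {n : ℕ} (X Y : Fin n → ℝ) (y : ℝ) (f : ℝ → ℝ) : Prop :=
  AntitoneOn f (designPoints X : Set ℝ) ∧
    ∀ g : ℝ → ℝ, AntitoneOn g (designPoints X : Set ℝ) →
      lsCriterion X Y y f ≤ lsCriterion X Y y g

/-- `Q x β` is a plug-in estimator of the quantile curves on `𝒳`: for each `β ∈ (0,1)` it is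
isotonic in `x ∈ 𝒳`, and at each design point `x` it is a `β`-quantile of the estimated
distribution function `Fhat x`. -/
def IsPlugInEstimator (𝒳 : Set ℝ) {n : ℕ} (X Y : Fin n → ℝ) (Q : ℝ → ℝ → ℝ) : Prop :=
  ∃ Fhat : ℝ → ℝ → ℝ, (∀ y, IsAntitonicLSE X Y y (fun x => Fhat x y)) ∧
    ∀ β ∈ Ioo (0 : ℝ) 1,
      MonotoneOn (fun x => Q x β) 𝒳 ∧
      ∀ x ∈ designPoints X, IsQuantile (Fhat x) β (Q x β)

/-! ### The observation model -/

/-- The σ-field generated by the vector `(X i)ᵢ`. -/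
abbrev designSigma {Ω : Type*} {n : ℕ} (X : Fin n → Ω → ℝ) : MeasurableSpace Ω :=
  MeasurableSpace.comap (fun ω i => X i ω) MeasurableSpace.pi

/-- Observations `(X i, Y i)` with covariates in `𝒳` such that, conditional on the vector
`X = (X i)ᵢ`, the `Y i` are independent with distribution functions `F (X i)`.
Conditional independence is expressed through conditional probabilities (taking `B i = univ`
covers subfamilies); this needs no regular conditional distribution on `Ω`. -/
structure IsRegressionSample {Ω : Type*} [MeasurableSpace Ω] (μ : Measure Ω)
    (𝒳 : Set ℝ) (F : ℝ → ℝ → ℝ) {n : ℕ} (X Y : Fin n → Ω → ℝ) : Prop where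
  measurable_X : ∀ i, Measurable (X i)
  measurable_Y : ∀ i, Measurable (Y i)
  mem_X : ∀ i ω, X i ω ∈ 𝒳
  cond_indep : ∀ B : Fin n → Set ℝ, (∀ i, MeasurableSet (B i)) →
    μ⟦⋂ i, Y i ⁻¹' B i | designSigma X⟧ =ᵐ[μ] ∏ i, μ⟦Y i ⁻¹' B i | designSigma X⟧
  cond_cdf : ∀ i y, μ⟦{ω | Y i ω ≤ y} | designSigma X⟧ =ᵐ[μ] fun ω => F (X i ω) y

/-! ### Rates and assumptions -/

/-- `ρₙ = log n / n`. -/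
def rho (n : ℕ) : ℝ := Real.log n / n

/-- `δₙ = C₃ ρₙ ^ (1 / (2α + 1))`. -/
def bandwidth (C₃ α : ℝ) (n : ℕ) : ℝ := C₃ * rho n ^ (1 / (2 * α + 1))

/-- `Iₙ = {x | [x - δₙ, x + δₙ] ⊆ I}`. -/
def innerSet (I : Set ℝ) (δ : ℝ) : Set ℝ := {x | Icc (x - δ) (x + δ) ⊆ I}

/-- Hölder condition on `x ↦ F_x(y)`, `x ∈ I`, uniformly in `y ∈ J`. -/
def HolderCDF (F : ℝ → ℝ → ℝ) (I J : Set ℝ) (α C₁ : ℝ) : Prop :=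
  ∀ w ∈ I, ∀ x ∈ I, ∀ y ∈ J, |F w y - F x y| ≤ C₁ * |w - x| ^ α

/-- Every interval `T ⊆ I` of length at least `δ` satisfies `#{i | X i ∈ T} ≥ C₂ n λ(T)`. -/
def DenseDesign {n : ℕ} (X : Fin n → ℝ) (I : Set ℝ) (C₂ δ : ℝ) : Prop :=
  ∀ T : Set ℝ, T.OrdConnected → T ⊆ I → ENNReal.ofReal δ ≤ volume T →
    ENNReal.ofReal C₂ * ((n : ENNReal) * volume T) ≤ (designCount X T : ENNReal)

/-- Growth condition on the distribution functions `F_x`, `x ∈ I`, at levels in `(β₁, β₂)`. -/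
def GrowthCDF (F : ℝ → ℝ → ℝ) (I : Set ℝ) (β₁ β₂ κ : ℝ) : Prop :=
  ∀ x ∈ I, ∀ y₁ y₂ : ℝ, y₁ < y₂ → F x y₁ ∈ Ioo β₁ β₂ →
    Function.leftLim (F x) y₂ ∈ Ioo β₁ β₂ → κ * (y₂ - y₁) ≤ F x y₂ - F x y₁

end

/-! At each level y the antitonic fit satisfies one half of a min-max formula. Its value at a design
point is at most the empirical frequency of {Y ≤ y} over some block of design points with a
prescribed left end, and at least the frequency over some block with a prescribed right end. The
free end of the block is unknown, but this costs nothing: F is antitone in x, so the mean frequency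
is controlled by the prescribed end, and a longer block only reduces the noise.

The noise is bounded at once over all blocks and all y. Hoeffding's inequality on a grid of
half-lines gives a Dvoretzky-Kiefer-Wolfowitz type bound for independent, non-identical variables,
and a union over the pairs of block ends gives deviations of order √(N log n), for blocks of N
observations, outside an event of probability O(1/n).

A window of length δₙ next to x holds at least C₂nδₙ observations. There the bias C₁δₙ^α and the
noise √(log n / (nδₙ)) are both of order ρₙ^(α/(2α+1)). So the fitted distribution function at some
design point left of x is at most F_x + Δ, and at some design point right of x it is at least F_x -
Δ. Isotonicity of the estimator puts its value at x between the corresponding quantiles, and the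
growth condition turns an error Δ in level into an error 2Δ/κ in quantile. The lemmas that carry
this are `IsRegressionSample.measure_exists_lt_abs_centredCount_le`, `IsAntitonicLSE.le_add_sqrt`,
`IsAntitonicLSE.sub_sqrt_le` and `abs_sub_le_of_quantile_bracket`. -/

noncomputable section


/-! ### Uniform deviations of sums of indicators over half-lines -/

/-- Two-sided Hoeffding inequality for the number of coordinates falling in a set. -/
theorem pi_real_le_abs_sum_indicator_sub {ι : Type*} [Fintype ι] (p : ι → Measure ℝ)
    [∀ i, IsProbabilityMeasure (p i)] (S : Finset ι) {A : Set ℝ} (hA : MeasurableSet A)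
    {t : ℝ} (ht : 0 ≤ t) :
    (Measure.pi p).real {ω | t ≤ |∑ i ∈ S, (A.indicator 1 (ω i) - (p i).real A)|}
      ≤ 2 * Real.exp (-2 * t ^ 2 / S.card) := by
  have hmeas : Measurable (A.indicator (1 : ℝ → ℝ)) := measurable_one.indicator hA
  have hind : iIndepFun (fun i (ω : ι → ℝ) => A.indicator (1 : ℝ → ℝ) (ω i) - (p i).real A)
      (Measure.pi p) :=
    iIndepFun_pi (X := fun i y => A.indicator (1 : ℝ → ℝ) y - (p i).real A)
      fun i => (hmeas.sub_const _).aemeasurable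
  have hsub : ∀ i ∈ S, HasSubgaussianMGF
      (fun ω : ι → ℝ => A.indicator (1 : ℝ → ℝ) (ω i) - (p i).real A)
      ((‖(1 : ℝ) - 0‖₊ / 2) ^ 2) (Measure.pi p) := by
    intro i _
    have h := hasSubgaussianMGF_of_mem_Icc (μ := Measure.pi p) (a := 0) (b := 1)
      (X := fun ω : ι → ℝ => A.indicator (1 : ℝ → ℝ) (ω i))
      (hmeas.comp (measurable_pi_apply i)).aemeasurable
      (Eventually.of_forall fun ω => by
        by_cases h : ω i ∈ A <;> simp [h])
    have hint : ∫ ω : ι → ℝ, A.indicator (1 : ℝ → ℝ) (ω i) ∂(Measure.pi p) = (p i).real A := by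
      rw [← integral_indicator_one hA, ← (measurePreserving_eval p i).map_eq,
        integral_map (measurable_pi_apply i).aemeasurable hmeas.aestronglyMeasurable]
    rwa [hint] at h
  have hsum := HasSubgaussianMGF.sum_of_iIndepFun hind hsub
  -- Each centred indicator has variance proxy 1/4, so the sum has proxy N/4, where N is the size of
  -- `S`.
  have hexp : Real.exp (-t ^ 2 / (2 * ((∑ _i ∈ S, (‖(1 : ℝ) - 0‖₊ / 2) ^ 2 : NNReal) : ℝ)))
      = Real.exp (-2 * t ^ 2 / S.card) := by
    congr 1
    simp only [sub_zero, nnnorm_one, Finset.sum_const, nsmul_eq_mul]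
    push_cast
    rcases eq_or_ne (S.card : ℝ) 0 with h | h
    · simp [h]
    · field_simp
  have h1 := hsum.measure_ge_le ht
  have h2 := hsum.neg.measure_ge_le ht
  rw [hexp] at h1 h2
  have hsubset : {ω : ι → ℝ | t ≤ |∑ i ∈ S, (A.indicator 1 (ω i) - (p i).real A)|} ⊆
      {ω | t ≤ ∑ i ∈ S, (A.indicator 1 (ω i) - (p i).real A)} ∪
      {ω | t ≤ (-fun ω : ι → ℝ => ∑ i ∈ S, (A.indicator (1 : ℝ → ℝ) (ω i) - (p i).real A)) ω} := by
    intro ω hω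
    simpa [le_abs] using hω
  calc _ ≤ _ := measureReal_mono hsubset
    _ ≤ _ := measureReal_union_le _ _
    _ ≤ _ := by linarith

/-- The smallest point at which the distribution function of `m` reaches the level `k`. -/
def levelPoint (m : Measure ℝ) (k : ℕ) : ℝ := sInf {y | (k : ℝ) ≤ m.real (Iic y)}

/-- Mass vanishes at -∞, so for k > 0 the level set is bounded below and its `sInf` is a true
infimum, not the default value. -/
theorem levelPoint_le {m : Measure ℝ} [IsFiniteMeasure m] {k : ℕ} (hk : 0 < k) {y : ℝ}
    (hy : (k : ℝ) ≤ m.real (Iic y)) : levelPoint m k ≤ y := by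
  refine csInf_le ?_ hy
  have hInter : ⋂ n : ℕ, Iic (-(n : ℝ)) = ∅ := by
    ext x
    simp only [mem_iInter, mem_Iic, mem_empty_iff_false, iff_false, not_forall, not_le]
    obtain ⟨n, hn⟩ := exists_nat_gt (-x)
    exact ⟨n, by linarith⟩
  have h : Tendsto (fun n : ℕ => m (Iic (-(n : ℝ)))) atTop (𝓝 0) := by
    rw [← measure_empty (μ := m), ← hInter]
    exact tendsto_measure_iInter_atTop (fun n => measurableSet_Iic.nullMeasurableSet)
      (fun a b hab => Iic_subset_Iic.2 (by simpa using hab)) ⟨0, measure_ne_top _ _⟩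
  have h' := (ENNReal.tendsto_toReal ENNReal.zero_ne_top).comp h
  obtain ⟨n, hn⟩ := (h'.eventually_lt_const (by simpa using hk : (0 : ENNReal).toReal < k)).exists
  set a := -(n : ℝ)
  have ha : m.real (Iic a) < k := hn
  refine ⟨a, fun z hz => ?_⟩
  by_contra! hza
  have := measureReal_mono (μ := m) (Iic_subset_Iic.2 hza.le)
  have hz' : (k : ℝ) ≤ m.real (Iic z) := hz
  linarith

theorem le_measureReal_Iic_levelPoint {m : Measure ℝ} [IsFiniteMeasure m] {k : ℕ} {y : ℝ}
    (hy : (k : ℝ) ≤ m.real (Iic y)) : (k : ℝ) ≤ m.real (Iic (levelPoint m k)) := by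
  set z := levelPoint m k with hz
  have hlt : ∀ u, z < u → (k : ℝ) ≤ m.real (Iic u) := by
    intro u hu
    obtain ⟨v, hv, hvu⟩ := exists_lt_of_csInf_lt ⟨y, hy⟩ hu
    exact le_trans hv (measureReal_mono (Iic_subset_Iic.2 hvu.le))
  obtain ⟨u, hu, huz, hut⟩ := exists_seq_strictAnti_tendsto z
  have hInter : ⋂ n, Iic (u n) = Iic z := by
    ext x
    simp only [mem_iInter, mem_Iic]
    exact ⟨fun h => ge_of_tendsto' hut h, fun h n => h.trans (huz n).le⟩
  have ht : Tendsto (fun n => m (Iic (u n))) atTop (𝓝 (m (Iic z))) := by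
    rw [← hInter]
    exact tendsto_measure_iInter_atTop (fun n => measurableSet_Iic.nullMeasurableSet)
      (fun a b hab => Iic_subset_Iic.2 (hu.antitone hab)) ⟨0, measure_ne_top _ _⟩
  have ht' := (ENNReal.tendsto_toReal (measure_ne_top m (Iic z))).comp ht
  exact ge_of_tendsto' ht' fun n => hlt _ (huz n)

theorem measureReal_Iio_levelPoint_le {m : Measure ℝ} [IsFiniteMeasure m] {k : ℕ} (hk : 0 < k) :
    m.real (Iio (levelPoint m k)) ≤ k := by
  set z := levelPoint m k with hz
  obtain ⟨u, hu, huz, hut⟩ := exists_seq_strictMono_tendsto z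
  have ht : Tendsto (fun n => m (Iic (u n))) atTop (𝓝 (m (Iio z))) := by
    rw [← iUnion_Iic_eq_Iio_of_lt_of_tendsto huz hut]
    exact tendsto_measure_iUnion_atTop (fun a b hab => Iic_subset_Iic.2 (hu.monotone hab))
  have ht' := (ENNReal.tendsto_toReal (measure_ne_top m (Iio z))).comp ht
  refine le_of_tendsto' ht' fun n => ?_
  by_contra! h
  exact absurd (levelPoint_le hk h.le) (not_le.2 (huz n))

/-- A monotone set function which is close to a measure on the half-lines given by the level
points is uniformly close to it on all half-lines. -/
theorem abs_sub_measureReal_Iic_le {m : Measure ℝ} [IsFiniteMeasure m] {N : ℕ}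
    (hm : m.real univ = N) {K : Set ℝ → ℝ} (hK : Monotone K) (hK0 : ∀ A, 0 ≤ K A)
    (hKN : ∀ A, K A ≤ N) {t : ℝ} (ht : 0 ≤ t)
    (h1 : ∀ k ∈ Finset.range (N + 1), |K (Iic (levelPoint m k)) - m.real (Iic (levelPoint m k))| ≤ t)
    (h2 : ∀ k ∈ Finset.range (N + 1), |K (Iio (levelPoint m k)) - m.real (Iio (levelPoint m k))| ≤ t)
    (y : ℝ) : |K (Iic y) - m.real (Iic y)| ≤ t + 1 := by
  set H := m.real (Iic y) with hH
  have hHN : H ≤ N := hm ▸ measureReal_mono (subset_univ _)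
  have hH0 : 0 ≤ H := measureReal_nonneg
  -- The points of levels k and k + 1 enclose y, and H lies in [k, k + 1); monotonicity of `K` then
  -- loses at most 1. If level k + 1 is never reached, the total mass N is at most k + 1, and the
  -- bound K ≤ N takes over.
  set k := ⌊H⌋₊ with hk
  have hkH : (k : ℝ) ≤ H := Nat.floor_le hH0
  have hHk : H < k + 1 := Nat.lt_floor_add_one H
  have hkN : k ≤ N := by exact_mod_cast hkH.trans hHN
  rw [abs_le]
  constructor
  · rcases Nat.eq_zero_or_pos k with h0 | h0
    · have := hK0 (Iic y)
      rw [h0] at hHk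
      norm_num at hHk
      linarith
    · have hle := levelPoint_le h0 hkH
      have ha := (abs_le.1 (h1 k (Finset.mem_range.2 (by omega)))).1
      have hb := le_measureReal_Iic_levelPoint hkH
      have hc := hK (Iic_subset_Iic.2 hle)
      linarith
  · by_cases hex : ∃ z, ((k + 1 : ℕ) : ℝ) ≤ m.real (Iic z)
    · obtain ⟨z, hz⟩ := hex
      have hkN' : k + 1 ≤ N := by
        have : ((k + 1 : ℕ) : ℝ) ≤ N := hz.trans (hm ▸ measureReal_mono (subset_univ _))
        exact_mod_cast this
      have hlt : y < levelPoint m (k + 1) := by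
        by_contra! h
        have := le_measureReal_Iic_levelPoint hz
        have h' := measureReal_mono (μ := m) (Iic_subset_Iic.2 h)
        push_cast at this
        linarith
      have ha := (abs_le.1 (h2 (k + 1) (Finset.mem_range.2 (by omega)))).2
      have hb := measureReal_Iio_levelPoint_le (m := m) (Nat.succ_pos k)
      have hc : K (Iic y) ≤ K (Iio (levelPoint m (k + 1))) := hK (Iic_subset_Iio.2 hlt)
      push_cast at hb
      linarith
    · push Not at hex
      have hlim : Tendsto (fun x => m.real (Iic x)) atTop (𝓝 (m.real univ)) :=
        (ENNReal.tendsto_toReal (measure_ne_top m univ)).comp (tendsto_measure_Iic_atTop m)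
      have := le_of_tendsto' hlim fun x => (hex x).le
      rw [hm] at this
      push_cast at this
      have := hKN (Iic y)
      linarith

/-- Uniform deviation bound for the empirical distribution function of independent, not
necessarily identically distributed, random variables. -/
theorem pi_exists_lt_abs_sum_indicator_Iic_sub_le {ι : Type*} [Fintype ι] (p : ι → Measure ℝ)
    [∀ i, IsProbabilityMeasure (p i)] (S : Finset ι) {t : ℝ} (ht : 0 ≤ t) :
    Measure.pi p {ω | ∃ y : ℝ,
        t + 1 < |∑ i ∈ S, ((Iic y).indicator 1 (ω i) - (p i).real (Iic y))|}
      ≤ ENNReal.ofReal (4 * (S.card + 1) * Real.exp (-2 * t ^ 2 / S.card)) := by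
  set m : Measure ℝ := ∑ i ∈ S, p i with hmdef
  have hmr : ∀ A, m.real A = ∑ i ∈ S, (p i).real A := by
    intro A
    simp only [hmdef, Measure.real, Measure.finsetSum_apply]
    exact ENNReal.toReal_sum fun i _ => measure_ne_top _ _
  have hmu : m.real univ = S.card := by simp [hmr]
  have hfin : IsFiniteMeasure m := by
    rw [hmdef]; infer_instance
  let bad : Set ℝ → Set (ι → ℝ) := fun A =>
    {ω | t ≤ |∑ i ∈ S, (A.indicator 1 (ω i) - (p i).real A)|}
  have hbad : ∀ A, MeasurableSet A → Measure.pi p (bad A)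
      ≤ ENNReal.ofReal (2 * Real.exp (-2 * t ^ 2 / S.card)) := by
    intro A hA
    rw [← ofReal_measureReal (measure_ne_top _ _)]
    exact ENNReal.ofReal_le_ofReal (pi_real_le_abs_sum_indicator_sub p S hA ht)
  have hsub : {ω : ι → ℝ | ∃ y : ℝ,
        t + 1 < |∑ i ∈ S, ((Iic y).indicator 1 (ω i) - (p i).real (Iic y))|} ⊆
      ⋃ k ∈ Finset.range (S.card + 1), (bad (Iic (levelPoint m k)) ∪ bad (Iio (levelPoint m k))) := by
    intro ω ⟨y, hy⟩
    by_contra hω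
    simp only [mem_iUnion, not_exists, mem_union, not_or] at hω
    refine absurd hy (not_lt.2 ?_)
    have key := abs_sub_measureReal_Iic_le (m := m) (N := S.card) hmu
      (K := fun A => ∑ i ∈ S, A.indicator (1 : ℝ → ℝ) (ω i)) ?_ ?_ ?_ ht ?_ ?_ y
    · simpa only [hmr, ← Finset.sum_sub_distrib] using key
    · intro A B hAB
      exact Finset.sum_le_sum fun i _ => indicator_le_indicator_of_subset hAB (fun _ => zero_le_one) _
    · intro A
      exact Finset.sum_nonneg fun i _ => indicator_nonneg (fun _ _ => zero_le_one) _
    · intro A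
      refine (Finset.sum_le_card_nsmul _ _ 1 fun i _ => ?_).trans (by simp)
      by_cases h : ω i ∈ A <;> simp [h]
    · intro k hk
      have := (hω k hk).1
      simp only [bad, mem_ofPred_eq, not_le] at this
      simpa only [hmr, ← Finset.sum_sub_distrib] using this.le
    · intro k hk
      have := (hω k hk).2
      simp only [bad, mem_ofPred_eq, not_le] at this
      simpa only [hmr, ← Finset.sum_sub_distrib] using this.le
  have he : 0 ≤ 2 * Real.exp (-2 * t ^ 2 / S.card) := by positivity
  calc _ ≤ _ := measure_mono hsub
    _ ≤ ∑ k ∈ Finset.range (S.card + 1),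
        Measure.pi p (bad (Iic (levelPoint m k)) ∪ bad (Iio (levelPoint m k))) :=
      measure_biUnion_finset_le _ _
    _ ≤ ∑ _k ∈ Finset.range (S.card + 1),
        ENNReal.ofReal (2 * (2 * Real.exp (-2 * t ^ 2 / S.card))) := by
      refine Finset.sum_le_sum fun k _ => (measure_union_le _ _).trans ?_
      rw [two_mul, ENNReal.ofReal_add he he]
      exact add_le_add (hbad _ measurableSet_Iic) (hbad _ measurableSet_Iio)
    _ = _ := by
      rw [Finset.sum_const, Finset.card_range, nsmul_eq_mul, ← ENNReal.ofReal_natCast,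
        ← ENNReal.ofReal_mul (by positivity)]
      congr 1
      push_cast
      ring


/-! ### The conditional law of the responses -/

namespace IsDistributionFunction

variable {G : ℝ → ℝ}

theorem nonneg (hG : IsDistributionFunction G) (y : ℝ) : 0 ≤ G y :=
  hG.mono.le_of_tendsto hG.tendsto_atBot y

theorem le_one (hG : IsDistributionFunction G) (y : ℝ) : G y ≤ 1 :=
  hG.mono.ge_of_tendsto hG.tendsto_atTop y

/-- A distribution function, as a Stieltjes function. -/
def stieltjes (hG : IsDistributionFunction G) : StieltjesFunction ℝ :=
  ⟨G, hG.mono, hG.right_cont⟩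

/-- The probability measure with a given distribution function. -/
def law (hG : IsDistributionFunction G) : Measure ℝ := hG.stieltjes.measure

instance (hG : IsDistributionFunction G) : IsProbabilityMeasure hG.law :=
  hG.stieltjes.isProbabilityMeasure hG.tendsto_atBot hG.tendsto_atTop

theorem law_Iic (hG : IsDistributionFunction G) (y : ℝ) : hG.law (Iic y) = ENNReal.ofReal (G y) := by
  have := hG.stieltjes.measure_Iic hG.tendsto_atBot y
  rwa [sub_zero] at this

theorem law_real_Iic (hG : IsDistributionFunction G) (y : ℝ) : hG.law.real (Iic y) = G y := by
  rw [Measure.real, law_Iic, ENNReal.toReal_ofReal (hG.nonneg y)]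

end IsDistributionFunction

/-- A measure on `ι → ℝ` that has product form on rational lower orthants is a product measure. -/
theorem pi_eq_of_forall_rat {ι : Type*} [Fintype ι] (p : ι → Measure ℝ)
    [∀ i, IsProbabilityMeasure (p i)] (ν : Measure (ι → ℝ))
    (h : ∀ q : ι → ℚ, ν (pi univ fun i => Iic (q i : ℝ)) = ∏ i, p i (Iic (q i : ℝ))) :
    Measure.pi p = ν := by
  refine Measure.pi_eq_generateFrom (C := fun _ => ⋃ a : ℚ, {Iic (a : ℝ)})
    (fun _ => ?_) (fun _ => Real.isPiSystem_Iic_rat) (fun i => ?_) ?_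
  · rw [← Real.borel_eq_generateFrom_Iic_rat]
    exact (BorelSpace.measurable_eq (α := ℝ)).symm
  · refine ⟨fun n => Iic (n : ℝ), fun n => mem_iUnion.2 ⟨(n : ℚ), by simp⟩,
      fun n => measure_lt_top _ _, ?_⟩
    ext x
    simpa using exists_nat_ge x
  · intro s hs
    simp only [mem_iUnion, mem_singleton_iff] at hs
    choose q hq using hs
    obtain rfl : s = fun i => Iic (q i : ℝ) := funext hq
    exact h q

section Sample

variable {Ω : Type*} [MeasurableSpace Ω] {μ : Measure Ω} [IsProbabilityMeasure μ] {𝒳 : Set ℝ}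
  {F : ℝ → ℝ → ℝ} {n : ℕ} {X Y : Fin n → Ω → ℝ}

/-- Each conditional probability is determined only up to its own null set. Rational orthants leave
countably many null sets to discard and still determine a measure on the product space. -/
theorem IsRegressionSample.ae_condDistrib_eq_pi (h : IsRegressionSample μ 𝒳 F X Y)
    (hF : ∀ x ∈ 𝒳, IsDistributionFunction (F x)) :
    ∀ᵐ ω ∂μ, condDistrib (fun ω i => Y i ω) (fun ω i => X i ω) μ (fun i => X i ω)
      = Measure.pi fun i => (hF _ (h.mem_X i ω)).law := by
  have hX : Measurable fun ω i => X i ω := measurable_pi_lambda _ h.measurable_X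
  have hY : Measurable fun ω i => Y i ω := measurable_pi_lambda _ h.measurable_Y
  have hall : ∀ q : Fin n → ℚ, ∀ᵐ ω ∂μ,
      condDistrib (fun ω i => Y i ω) (fun ω i => X i ω) μ (fun i => X i ω)
        (pi univ fun i => Iic (q i : ℝ)) = ∏ i, (hF _ (h.mem_X i ω)).law (Iic (q i : ℝ)) := by
    intro q
    have hs : MeasurableSet (pi univ fun i => Iic (q i : ℝ)) :=
      MeasurableSet.univ_pi fun i => measurableSet_Iic
    have h1 := condDistrib_ae_eq_condExp (μ := μ) hX hY hs
    have h2 := h.cond_indep (fun i => Iic (q i : ℝ)) fun i => measurableSet_Iic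
    have h3 : ∀ᵐ ω ∂μ, ∀ i, (μ⟦Y i ⁻¹' Iic (q i : ℝ) | designSigma X⟧) ω = F (X i ω) (q i) :=
      ae_all_iff.2 fun i => h.cond_cdf i (q i)
    have hpre : (fun ω i => Y i ω) ⁻¹' (pi univ fun i => Iic (q i : ℝ))
        = ⋂ i, Y i ⁻¹' Iic (q i : ℝ) := by
      ext ω; simp [Pi.le_def]
    rw [hpre] at h1
    filter_upwards [h1, h2, h3] with ω h1 h2 h3
    have h12 := h1.trans h2
    rw [Finset.prod_apply] at h12
    simp only [h3] at h12
    rw [← ofReal_measureReal (measure_ne_top _ _), h12,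
      ENNReal.ofReal_prod_of_nonneg fun i _ => (hF _ (h.mem_X i ω)).nonneg _]
    simp only [IsDistributionFunction.law_Iic]
  filter_upwards [ae_all_iff.2 hall] with ω hω
  exact (pi_eq_of_forall_rat _ _ hω).symm

/-- If a measurable event has uniformly small probability for every fixed design, then it has
small probability. -/
theorem IsRegressionSample.measure_le (h : IsRegressionSample μ 𝒳 F X Y)
    (hF : ∀ x ∈ 𝒳, IsDistributionFunction (F x)) {B : Set ((Fin n → ℝ) × (Fin n → ℝ))}
    (hB : MeasurableSet B) {ε : ENNReal}
    (hε : ∀ (x : Fin n → ℝ) (hx : ∀ i, x i ∈ 𝒳),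
      (Measure.pi fun i => (hF _ (hx i)).law) {y | (x, y) ∈ B} ≤ ε) :
    μ {ω | ((fun i => X i ω), (fun i => Y i ω)) ∈ B} ≤ ε := by
  have hX : Measurable fun ω i => X i ω := measurable_pi_lambda _ h.measurable_X
  have hY : Measurable fun ω i => Y i ω := measurable_pi_lambda _ h.measurable_Y
  have hmap := compProd_map_condDistrib (μ := μ) (mβ := MeasurableSpace.pi)
    (X := fun ω i => X i ω) hY.aemeasurable
  calc μ {ω | ((fun i => X i ω), (fun i => Y i ω)) ∈ B}
      = (μ.map fun ω => ((fun i => X i ω), (fun i => Y i ω))) B :=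
        (Measure.map_apply (hX.prodMk hY) hB).symm
    _ = ∫⁻ ω, condDistrib (fun ω i => Y i ω) (fun ω i => X i ω) μ (fun i => X i ω)
          (Prod.mk (fun i => X i ω) ⁻¹' B) ∂μ := by
        rw [← hmap, Measure.compProd_apply hB,
          lintegral_map (Kernel.measurable_kernel_prodMk_left hB) hX]
    _ ≤ ∫⁻ _, ε ∂μ := by
        refine lintegral_mono_ae ?_
        filter_upwards [h.ae_condDistrib_eq_pi hF] with ω hω
        rw [hω]
        exact hε _ fun i => h.mem_X i ω
    _ = ε := by simp

end Sample

/-! ### Uniform deviations over intervals of design points -/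

/-- The indices of the design points between the `i`-th and the `j`-th one. -/
def indicesBetween {n : ℕ} (x : Fin n → ℝ) (i j : Fin n) : Finset (Fin n) :=
  Finset.univ.filter fun k => x i ≤ x k ∧ x k ≤ x j

/-- The centred number of responses not exceeding `q`, over a set of indices. -/
def centredCount {n : ℕ} (F : ℝ → ℝ → ℝ) (x y : Fin n → ℝ) (S : Finset (Fin n)) (q : ℝ) : ℝ :=
  ∑ k ∈ S, ((Iic q).indicator 1 (y k) - F (x k) q)

theorem indicator_Iic_continuousWithinAt (z q : ℝ) :
    Tendsto (fun q => (Iic q).indicator (1 : ℝ → ℝ) z) (𝓝[>] q)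
      (𝓝 ((Iic q).indicator (1 : ℝ → ℝ) z)) := by
  refine tendsto_const_nhds.congr' ?_
  by_cases hz : z ≤ q
  · filter_upwards [self_mem_nhdsWithin] with u hu
    simp [hz, hz.trans (le_of_lt hu)]
  · filter_upwards [Ioo_mem_nhdsGT (not_le.1 hz)] with u hu
    simp [hz, hu.2]

/-- The centred count is right-continuous in q, so a strict excess persists just to the right of q.
This makes the exceptional event a countable union, hence measurable. -/
theorem exists_rat_lt_abs_centredCount {n : ℕ} {F : ℝ → ℝ → ℝ} {x : Fin n → ℝ}
    (hF : ∀ i, IsDistributionFunction (F (x i))) (y : Fin n → ℝ) (S : Finset (Fin n)) {q c : ℝ}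
    (h : c < |centredCount F x y S q|) : ∃ r : ℚ, c < |centredCount F x y S r| := by
  have ht : Tendsto (fun q => |centredCount F x y S q|) (𝓝[>] q) (𝓝 |centredCount F x y S q|) :=
    (tendsto_finsetSum _ fun k _ => (indicator_Iic_continuousWithinAt _ _).sub
      (((hF k).right_cont q).mono_left (nhdsWithin_mono _ Ioi_subset_Ici_self))).abs
  obtain ⟨u, hu, hu'⟩ := (mem_nhdsGT_iff_exists_Ioo_subset).1 (ht.eventually_const_lt h)
  obtain ⟨r, hr1, hr2⟩ := exists_rat_btwn (show q < u from hu)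
  exact ⟨r, hu' ⟨hr1, hr2⟩⟩

/-- With t = 2√(N log n) the exponential is n⁻⁸ and the prefactor 4(N + 1) is at most 8n. The extra
1 in t + 1 is absorbed because √(N log n) ≥ 1/2. The power n⁻⁷ leaves room for a union over n²
blocks. -/
theorem pi_exists_lt_abs_centredCount_le {n : ℕ} (hn : 2 ≤ n) {F : ℝ → ℝ → ℝ} {x : Fin n → ℝ}
    (hF : ∀ i, IsDistributionFunction (F (x i))) (S : Finset (Fin n)) :
    (Measure.pi fun i => (hF i).law)
        {y | ∃ q : ℝ, 4 * √(S.card * Real.log n) < |centredCount F x y S q|}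
      ≤ ENNReal.ofReal (8 / n ^ 7) := by
  have hn' : (2 : ℝ) ≤ n := by exact_mod_cast hn
  rcases S.eq_empty_or_nonempty with rfl | hS
  · simp [centredCount]
  have hc : (1 : ℝ) ≤ S.card := by exact_mod_cast hS.card_pos
  have hcn : (S.card : ℝ) ≤ n := by exact_mod_cast (card_finset_fin_le S)
  have hlog : (1 / 4 : ℝ) ≤ Real.log n := by
    have := Real.log_le_log (by norm_num) hn'
    have := Real.log_two_gt_d9
    linarith
  have hs : 1 / 2 ≤ √(S.card * Real.log n) := by
    apply Real.le_sqrt_of_sq_le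
    nlinarith
  refine (measure_mono ?_).trans ((pi_exists_lt_abs_sum_indicator_Iic_sub_le
    (fun i => (hF i).law) S (t := 2 * √(S.card * Real.log n)) (by positivity)).trans
      (ENNReal.ofReal_le_ofReal ?_))
  · rintro y ⟨q, hq⟩
    refine ⟨q, ?_⟩
    simp only [IsDistributionFunction.law_real_Iic]
    exact lt_of_le_of_lt (by linarith) hq
  · have hexp : Real.exp (-2 * (2 * √(S.card * Real.log n)) ^ 2 / S.card) = ((n : ℝ) ^ 8)⁻¹ := by
      rw [mul_pow, Real.sq_sqrt (by positivity),
        show -2 * (2 ^ 2 * (S.card * Real.log n)) / (S.card : ℝ) = -(8 * Real.log n) by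
          field_simp; norm_num,
        Real.exp_neg, ← Real.exp_log (show (0 : ℝ) < n by linarith), ← Real.exp_nat_mul,
        Real.exp_log (by linarith)]
      norm_num
    rw [hexp, ← div_eq_mul_inv, div_le_div_iff₀ (by positivity) (by positivity)]
    have : (0 : ℝ) < (n : ℝ) ^ 7 := by positivity
    calc 4 * ((S.card : ℝ) + 1) * (n : ℝ) ^ 7 ≤ 8 * n * (n : ℝ) ^ 7 := by
          exact mul_le_mul_of_nonneg_right (by linarith) this.le
      _ = _ := by ring

/-- With high probability, the centred counts are small, simultaneously over all intervals of
design points and all levels. -/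
theorem IsRegressionSample.measure_exists_lt_abs_centredCount_le
    {Ω : Type*} [MeasurableSpace Ω] {μ : Measure Ω} [IsProbabilityMeasure μ] {𝒳 : Set ℝ}
    {F : ℝ → ℝ → ℝ} {n : ℕ} {X Y : Fin n → Ω → ℝ} (hn : 2 ≤ n)
    (h : IsRegressionSample μ 𝒳 F X Y)
    (hF : ∀ x ∈ 𝒳, IsDistributionFunction (F x))
    (hanti : ∀ y, AntitoneOn (fun x => F x y) 𝒳) :
    μ {ω | ∃ i j, ∃ q : ℝ,
        4 * √((indicesBetween (fun k => X k ω) i j).card * Real.log n)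
          < |centredCount F (fun k => X k ω) (fun k => Y k ω)
              (indicesBetween (fun k => X k ω) i j) q|}
      ≤ ENNReal.ofReal (8 / n) := by
  -- Off 𝒳 nothing is known about F. An antitone extension to ℝ is Borel, which makes the
  -- exceptional sets measurable in the design, and it agrees with F at all design points.
  have hext : ∀ q : ℝ, ∃ g : ℝ → ℝ, Antitone g ∧ EqOn (fun x => F x q) g 𝒳 := by
    intro q
    refine (hanti q).exists_antitone_extension ⟨0, ?_⟩ ⟨1, ?_⟩
    · rintro _ ⟨x, hx, rfl⟩
      exact (hF x hx).nonneg q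
    · rintro _ ⟨x, hx, rfl⟩
      exact (hF x hx).le_one q
  choose g hg hgF using hext
  let B : Fin n → Fin n → ℝ → Set ((Fin n → ℝ) × (Fin n → ℝ)) := fun i j q =>
    {z | 4 * √((indicesBetween z.1 i j).card * Real.log n)
      < |centredCount (fun x q => g q x) z.1 z.2 (indicesBetween z.1 i j) q|}
  have hBmeas : ∀ i j q, MeasurableSet (B i j q) := by
    intro i j q
    have hcond : ∀ k, MeasurableSet
        {z : (Fin n → ℝ) × (Fin n → ℝ) | z.1 i ≤ z.1 k ∧ z.1 k ≤ z.1 j} := by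
      intro k
      have hk : ∀ k, Measurable fun z : (Fin n → ℝ) × (Fin n → ℝ) => z.1 k := by fun_prop
      exact (measurableSet_le (hk i) (hk k)).inter (measurableSet_le (hk k) (hk j))
    refine measurableSet_lt ?_ ?_
    · have : Measurable fun z : (Fin n → ℝ) × (Fin n → ℝ) =>
          ((indicesBetween z.1 i j).card : ℝ) := by
        simp only [indicesBetween, Finset.card_filter]
        push_cast
        exact Finset.measurable_sum _ fun k _ =>
          Measurable.ite (hcond k) measurable_const measurable_const
      fun_prop
    · have : Measurable fun z : (Fin n → ℝ) × (Fin n → ℝ) =>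
          centredCount (fun x q => g q x) z.1 z.2 (indicesBetween z.1 i j) q := by
        simp only [centredCount, indicesBetween, Finset.sum_filter]
        refine Finset.measurable_sum _ fun k _ => Measurable.ite (hcond k) ?_ measurable_const
        refine Measurable.sub ?_ ?_
        · exact (measurable_one.indicator measurableSet_Iic).comp (by fun_prop)
        · exact (hg q).measurable.comp (by fun_prop)
      exact this.abs
  have heq : ∀ x : Fin n → ℝ, (∀ k, x k ∈ 𝒳) → ∀ y S q,
      centredCount (fun x q => g q x) x y S q = centredCount F x y S q := by
    intro x hx y S q
    exact Finset.sum_congr rfl fun k _ => by simp only [← hgF q (hx k)]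
  have hsub : {ω | ∃ i j, ∃ q : ℝ,
        4 * √((indicesBetween (fun k => X k ω) i j).card * Real.log n)
          < |centredCount F (fun k => X k ω) (fun k => Y k ω)
              (indicesBetween (fun k => X k ω) i j) q|} ⊆
      {ω | ((fun i => X i ω), (fun i => Y i ω)) ∈ ⋃ i, ⋃ j, ⋃ q : ℚ, B i j q} := by
    rintro ω ⟨i, j, q, hq⟩
    obtain ⟨r, hr⟩ := exists_rat_lt_abs_centredCount (fun k => hF _ (h.mem_X k ω)) _ _ hq
    refine mem_iUnion.2 ⟨i, mem_iUnion.2 ⟨j, mem_iUnion.2 ⟨r, ?_⟩⟩⟩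
    change _ < |centredCount (fun x q => g q x) _ _ _ _|
    rw [heq _ fun k => h.mem_X k ω]
    exact hr
  refine (measure_mono hsub).trans (h.measure_le hF (MeasurableSet.iUnion fun i =>
    MeasurableSet.iUnion fun j => MeasurableSet.iUnion fun q : ℚ => hBmeas i j q) ?_)
  intro x hx
  have hn0 : (2 : ℝ) ≤ n := by exact_mod_cast hn
  have hsub' : {y | (x, y) ∈ ⋃ i, ⋃ j, ⋃ q : ℚ, B i j q} ⊆ ⋃ i, ⋃ j,
      {y | ∃ q : ℝ, 4 * √((indicesBetween x i j).card * Real.log n)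
        < |centredCount F x y (indicesBetween x i j) q|} := by
    intro y hy
    simp only [mem_ofPred_eq, mem_iUnion] at hy ⊢
    obtain ⟨i, j, q, hq⟩ := hy
    refine ⟨i, j, q, ?_⟩
    change _ < |centredCount (fun x q => g q x) _ _ _ _| at hq
    rwa [heq x hx] at hq
  calc _ ≤ _ := measure_mono hsub'
    _ ≤ ∑ i, ∑ j, _ := (measure_iUnion_fintype_le _ _).trans
        (Finset.sum_le_sum fun i _ => measure_iUnion_fintype_le _ _)
    _ ≤ ∑ _i : Fin n, ∑ _j : Fin n, ENNReal.ofReal (8 / n ^ 7) :=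
        Finset.sum_le_sum fun i _ => Finset.sum_le_sum fun j _ =>
          pi_exists_lt_abs_centredCount_le hn (fun k => hF _ (hx k)) _
    _ ≤ ENNReal.ofReal (8 / n) := by
        simp only [Finset.sum_const, Finset.card_univ, Fintype.card_fin, nsmul_eq_mul]
        rw [← ENNReal.ofReal_natCast, ← ENNReal.ofReal_mul (by positivity),
          ← ENNReal.ofReal_mul (by positivity)]
        apply ENNReal.ofReal_le_ofReal
        have h4 : (1 : ℝ) ≤ (n : ℝ) ^ 4 := one_le_pow₀ (by linarith)
        have : (n : ℝ) * (n * (8 / n ^ 7)) = 8 / n / n ^ 4 := by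
          field_simp
        rw [this]
        exact div_le_self (by positivity) h4


/-! ### One-sided min-max inequalities for the antitonic least squares estimator -/

section LSE

variable {n : ℕ} {X Y : Fin n → ℝ} {y : ℝ} {f : ℝ → ℝ}

theorem designCount_singleton_mul_empiricalCDF (x y : ℝ) :
    (designCount X {x} : ℝ) * empiricalCDF X Y x y
      = ((Finset.univ.filter fun i => X i = x ∧ Y i ≤ y).card : ℝ) := by
  unfold empiricalCDF
  rcases eq_or_ne (designCount X {x} : ℝ) 0 with h | h
  · rw [h, zero_mul, eq_comm, Nat.cast_eq_zero, Finset.card_eq_zero, Finset.filter_eq_empty_iff]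
    rintro i - ⟨hi, -⟩
    rw [Nat.cast_eq_zero, designCount, Finset.card_eq_zero, Finset.filter_eq_empty_iff] at h
    exact h (Finset.mem_univ i) hi
  · exact mul_div_cancel₀ _ h

/-- Sums over design points of weighted empirical distribution functions are counts. -/
theorem sum_designCount_mul_empiricalCDF_sub (y v : ℝ) (P : ℝ → Prop) [DecidablePred P] :
    ∑ x ∈ (designPoints X).filter P, (designCount X {x} : ℝ) * (empiricalCDF X Y x y - v)
      = ∑ i ∈ Finset.univ.filter fun i => P (X i), ((Iic y).indicator 1 (Y i) - v) := by
  classical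
  have hfib : ∀ x ∈ (designPoints X).filter P,
      (designCount X {x} : ℝ) * (empiricalCDF X Y x y - v)
        = ∑ i ∈ (Finset.univ.filter fun i => P (X i)).filter fun i => X i = x,
            ((Iic y).indicator 1 (Y i) - v) := by
    intro x hx
    have hP := (Finset.mem_filter.1 hx).2
    have : (Finset.univ.filter fun i => P (X i)).filter (fun i => X i = x)
        = Finset.univ.filter fun i => X i = x := by
      ext i
      simp only [Finset.mem_filter, Finset.mem_univ, true_and, and_iff_right_iff_imp]
      rintro rfl; exact hP
    rw [this, mul_sub, designCount_singleton_mul_empiricalCDF, Finset.sum_sub_distrib,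
      Finset.sum_const, nsmul_eq_mul]
    congr 1
    · simp only [indicator_apply, mem_Iic, Pi.one_apply, Finset.sum_boole, Finset.filter_filter]
  rw [Finset.sum_congr rfl hfib]
  refine Finset.sum_fiberwise_of_maps_to (fun i hi => ?_) _
  simp only [Finset.mem_filter, Finset.mem_univ, true_and] at hi
  simp [designPoints, hi]

/-- First-order condition: if all sufficiently small shifts of `f` on a set of design points keep
it antitonic, then the derivative of the criterion along the shift is nonnegative. -/
theorem IsAntitonicLSE.sum_nonneg (hf : IsAntitonicLSE X Y y f) (P : ℝ → Prop) [DecidablePred P]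
    (s : ℝ) {ε₀ : ℝ} (hε₀ : 0 < ε₀)
    (hP : ∀ ε, 0 < ε → ε < ε₀ →
      AntitoneOn (fun x => if P x then f x - s * ε else f x) (designPoints X : Set ℝ)) :
    0 ≤ s * ∑ x ∈ (designPoints X).filter P,
      (designCount X {x} : ℝ) * (empiricalCDF X Y x y - f x) := by
  set A := ∑ x ∈ (designPoints X).filter P,
      (designCount X {x} : ℝ) * (empiricalCDF X Y x y - f x) with hA
  set W := ∑ x ∈ (designPoints X).filter P, (designCount X {x} : ℝ) with hW
  -- The change of the criterion is quadratic in ε; it is divided by ε > 0 before letting ε tend to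
  -- 0.
  have key : ∀ ε, 0 < ε → ε < ε₀ → 0 ≤ 2 * (s * A) + ε * (s ^ 2 * W) := by
    intro ε h0 h1
    have h := hf.2 _ (hP ε h0 h1)
    have hdiff : lsCriterion X Y y (fun x => if P x then f x - s * ε else f x)
        - lsCriterion X Y y f = ε * (2 * (s * A) + ε * (s ^ 2 * W)) := by
      have e : ε * (2 * (s * A) + ε * (s ^ 2 * W))
          = 2 * s * ε * A + ε ^ 2 * s ^ 2 * W := by ring
      rw [e, hA, hW, Finset.mul_sum, Finset.mul_sum, ← Finset.sum_add_distrib, Finset.sum_filter,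
        lsCriterion, lsCriterion, ← Finset.sum_sub_distrib]
      refine Finset.sum_congr rfl fun x _ => ?_
      split_ifs <;> ring
    have : 0 ≤ ε * (2 * (s * A) + ε * (s ^ 2 * W)) := by rw [← hdiff]; linarith
    exact nonneg_of_mul_nonneg_right this h0
  have ht : Tendsto (fun ε : ℝ => 2 * (s * A) + ε * (s ^ 2 * W)) (𝓝[>] 0)
      (𝓝 (2 * (s * A) + 0 * (s ^ 2 * W))) := by
    refine Tendsto.mono_left ?_ nhdsWithin_le_nhds
    exact (Continuous.tendsto (by fun_prop) 0)
  have := ge_of_tendsto ht (by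
    filter_upwards [Ioo_mem_nhdsGT hε₀] with ε hε using key ε hε.1 hε.2)
  linarith

/-- A finite set of reals has a positive gap below (or above) a level. -/
theorem exists_pos_forall_lt_add_le (D : Finset ℝ) (f : ℝ → ℝ) (v : ℝ) :
    ∃ ε₀ > 0, ∀ x ∈ D, (f x < v → f x + ε₀ ≤ v) ∧ (v < f x → v + ε₀ ≤ f x) := by
  classical
  induction D using Finset.induction_on with
  | empty => exact ⟨1, one_pos, by simp⟩
  | insert a D _ ih =>
    obtain ⟨ε, hε, h⟩ := ih
    rcases eq_or_ne (f a) v with ha | ha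
    · refine ⟨ε, hε, fun x hx => ?_⟩
      rcases Finset.mem_insert.1 hx with rfl | hx
      · constructor <;> intro h' <;> linarith
      · exact h x hx
    · refine ⟨min ε |f a - v|, lt_min hε (abs_pos.2 (sub_ne_zero.2 ha)), fun x hx => ?_⟩
      rcases Finset.mem_insert.1 hx with rfl | hx
      · have := min_le_right ε |f x - v|
        constructor <;> intro h'
        · linarith [abs_of_neg (sub_neg.2 h')]
        · linarith [abs_of_pos (sub_pos.2 h')]
      · have := min_le_left ε |f a - v|
        exact ⟨fun h' => by linarith [(h x hx).1 h'], fun h' => by linarith [(h x hx).2 h']⟩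

theorem exists_eq_of_mem_designPoints {x : ℝ} (hx : x ∈ designPoints X) : ∃ i, X i = x := by
  simpa [designPoints] using hx

theorem mem_designPoints (i : Fin n) : X i ∈ designPoints X := by
  simp [designPoints]

/-- Upper bound: the value at the `j`-th index is bounded by the local frequency over an
interval of design points with prescribed left end. -/
theorem IsAntitonicLSE.exists_le_frequency (hf : IsAntitonicLSE X Y y f) (i j : Fin n) :
    ∃ k, X j ≤ X k ∧ 0 ≤ ∑ l ∈ indicesBetween X i k, ((Iic y).indicator 1 (Y l) - f (X j)) := by
  classical
  set v := f (X j) with hv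
  -- The block ends at the last point where f ≥ v. Beyond it f drops strictly below v, so f can be
  -- lowered slightly on the block without breaking antitonicity; on the block, f may be replaced by
  -- v in the resulting inequality.
  set T := (designPoints X).filter fun x => v ≤ f x with hT
  have hjT : X j ∈ T := Finset.mem_filter.2 ⟨mem_designPoints j, le_rfl⟩
  obtain ⟨k, hk⟩ := exists_eq_of_mem_designPoints
    (Finset.mem_filter.1 (T.max'_mem ⟨_, hjT⟩)).1
  have hjk : X j ≤ X k := hk ▸ T.le_max' _ hjT
  have hkv : v ≤ f (X k) := hk ▸ (Finset.mem_filter.1 (T.max'_mem ⟨_, hjT⟩)).2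
  have hiff : ∀ x ∈ designPoints X, x ≤ X k ↔ v ≤ f x := by
    intro x hx
    refine ⟨fun h => hkv.trans (hf.1 hx (mem_designPoints k) h), fun h => ?_⟩
    rw [hk]
    exact T.le_max' _ (Finset.mem_filter.2 ⟨hx, h⟩)
  refine ⟨k, hjk, ?_⟩
  obtain ⟨ε₀, hε₀, hgap⟩ := exists_pos_forall_lt_add_le (designPoints X) f v
  have h1 := hf.sum_nonneg (fun x => X i ≤ x ∧ x ≤ X k) 1 hε₀ ?_
  · have h2 : ∑ x ∈ (designPoints X).filter (fun x => X i ≤ x ∧ x ≤ X k),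
        (designCount X {x} : ℝ) * (empiricalCDF X Y x y - f x) ≤
        ∑ x ∈ (designPoints X).filter (fun x => X i ≤ x ∧ x ≤ X k),
        (designCount X {x} : ℝ) * (empiricalCDF X Y x y - v) := by
      refine Finset.sum_le_sum fun x hx => mul_le_mul_of_nonneg_left ?_ (Nat.cast_nonneg _)
      obtain ⟨hx, -, hxk⟩ := Finset.mem_filter.1 hx
      linarith [(hiff x hx).1 hxk]
    rw [sum_designCount_mul_empiricalCDF_sub] at h2
    rw [one_mul] at h1
    exact h1.trans h2
  · intro ε h0 h1 a ha b hb hab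
    have hfab := hf.1 ha hb hab
    simp only [one_mul]
    split_ifs with hb' ha' ha'
    · linarith
    · linarith
    · have hbk : f b < v := by
        by_contra! h
        exact hb' ⟨ha'.1.trans hab, (hiff b hb).2 h⟩
      have h3 := (hgap b hb).1 hbk
      have h4 := (hiff a ha).1 ha'.2
      linarith
    · exact hfab

/-- Lower bound: the value at the `j`-th index is bounded from below by the local frequency over
an interval of design points with prescribed right end. -/
theorem IsAntitonicLSE.exists_frequency_le (hf : IsAntitonicLSE X Y y f) (i j : Fin n) :
    ∃ k, X k ≤ X j ∧ ∑ l ∈ indicesBetween X k i, ((Iic y).indicator 1 (Y l) - f (X j)) ≤ 0 := by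
  classical
  set v := f (X j) with hv
  -- Mirror image: the block starts at the first point where f ≤ v, and f is raised there.
  set T := (designPoints X).filter fun x => f x ≤ v with hT
  have hjT : X j ∈ T := Finset.mem_filter.2 ⟨mem_designPoints j, le_rfl⟩
  obtain ⟨k, hk⟩ := exists_eq_of_mem_designPoints
    (Finset.mem_filter.1 (T.min'_mem ⟨_, hjT⟩)).1
  have hjk : X k ≤ X j := hk ▸ T.min'_le _ hjT
  have hkv : f (X k) ≤ v := hk ▸ (Finset.mem_filter.1 (T.min'_mem ⟨_, hjT⟩)).2
  have hiff : ∀ x ∈ designPoints X, X k ≤ x ↔ f x ≤ v := by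
    intro x hx
    refine ⟨fun h => (hf.1 (mem_designPoints k) hx h).trans hkv, fun h => ?_⟩
    rw [hk]
    exact T.min'_le _ (Finset.mem_filter.2 ⟨hx, h⟩)
  refine ⟨k, hjk, ?_⟩
  obtain ⟨ε₀, hε₀, hgap⟩ := exists_pos_forall_lt_add_le (designPoints X) f v
  have h1 := hf.sum_nonneg (fun x => X k ≤ x ∧ x ≤ X i) (-1) hε₀ ?_
  · have h2 : ∑ x ∈ (designPoints X).filter (fun x => X k ≤ x ∧ x ≤ X i),
        (designCount X {x} : ℝ) * (empiricalCDF X Y x y - v) ≤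
        ∑ x ∈ (designPoints X).filter (fun x => X k ≤ x ∧ x ≤ X i),
        (designCount X {x} : ℝ) * (empiricalCDF X Y x y - f x) := by
      refine Finset.sum_le_sum fun x hx => mul_le_mul_of_nonneg_left ?_ (Nat.cast_nonneg _)
      obtain ⟨hx, hxk, -⟩ := Finset.mem_filter.1 hx
      linarith [(hiff x hx).1 hxk]
    rw [sum_designCount_mul_empiricalCDF_sub] at h2
    exact h2.trans (by linarith)
  · intro ε h0 h1 a ha b hb hab
    have hfab := hf.1 ha hb hab
    simp only [neg_mul, one_mul]
    split_ifs with hb' ha' ha'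
    · linarith
    · have hak : v < f a := by
        by_contra! h
        exact ha' ⟨(hiff a ha).2 h, hab.trans hb'.2⟩
      have h3 := (hgap a ha).2 hak
      have h4 := (hiff b hb).1 hb'.1
      linarith
    · linarith
    · exact hfab

end LSE


/-! ### Consequences on the event of small deviations -/

section Deterministic

variable {n : ℕ} {X Y : Fin n → ℝ} {F : ℝ → ℝ → ℝ} {y : ℝ} {f : ℝ → ℝ}

/-- All centred counts over intervals of design points are of the order `√(N log n)`. -/
def SmallDeviations (F : ℝ → ℝ → ℝ) {n : ℕ} (X Y : Fin n → ℝ) : Prop :=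
  ∀ i j, ∀ q : ℝ, |centredCount F X Y (indicesBetween X i j) q|
    ≤ 4 * √((indicesBetween X i j).card * Real.log n)

theorem sum_indicator_sub_eq (S : Finset (Fin n)) (v : ℝ) :
    ∑ l ∈ S, ((Iic y).indicator 1 (Y l) - v)
      = centredCount F X Y S y + ∑ l ∈ S, (F (X l) y - v) := by
  rw [centredCount, ← Finset.sum_add_distrib]
  exact Finset.sum_congr rfl fun l _ => by ring

theorem le_four_mul_sqrt_div {N N₀ L d : ℝ} (hN₀ : 0 < N₀) (hN : N₀ ≤ N) (hL : 0 ≤ L)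
    (h : N * d ≤ 4 * √(N * L)) : d ≤ 4 * √(L / N₀) := by
  have hN' : 0 < N := hN₀.trans_le hN
  have h1 : √(N * L) = N * √(L / N) := by
    rw [show N * L = N ^ 2 * (L / N) by field_simp, Real.sqrt_mul (sq_nonneg _),
      Real.sqrt_sq hN'.le]
  have h2 : √(L / N) ≤ √(L / N₀) := Real.sqrt_le_sqrt (div_le_div_of_nonneg_left hL hN₀ hN)
  rw [h1] at h
  have : d ≤ 4 * √(L / N) := le_of_mul_le_mul_left (by linarith) hN'
  linarith

theorem indicesBetween_mono {i i' j j' : Fin n} (hi : X i' ≤ X i) (hj : X j ≤ X j') :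
    indicesBetween X i j ⊆ indicesBetween X i' j' := by
  intro k hk
  simp only [indicesBetween, Finset.mem_filter, Finset.mem_univ, true_and] at hk ⊢
  exact ⟨hi.trans hk.1, hk.2.trans hj⟩

/-- The block from i given by `IsAntitonicLSE.exists_le_frequency` contains all indices between i
and j, so N ≥ N₀, and the noise per observation, 4√(log n / N), decreases in N. -/
theorem IsAntitonicLSE.le_add_sqrt (hf : IsAntitonicLSE X Y y f) (hdev : SmallDeviations F X Y)
    {i j : Fin n} {N₀ c : ℝ} (hN₀ : 0 < N₀) (hcard : N₀ ≤ (indicesBetween X i j).card)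
    (hc : ∀ l, X i ≤ X l → F (X l) y ≤ c) : f (X j) ≤ c + 4 * √(Real.log n / N₀) := by
  obtain ⟨k, hjk, hk⟩ := hf.exists_le_frequency i j
  rw [sum_indicator_sub_eq (F := F) (X := X)] at hk
  have hsub : ((indicesBetween X i j).card : ℝ) ≤ (indicesBetween X i k).card := by
    exact_mod_cast Finset.card_le_card (indicesBetween_mono le_rfl hjk)
  have hsum : ∑ l ∈ indicesBetween X i k, (F (X l) y - f (X j))
      ≤ (indicesBetween X i k).card * (c - f (X j)) := by
    rw [← nsmul_eq_mul]
    refine Finset.sum_le_card_nsmul _ _ _ fun l hl => ?_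
    linarith [hc l (Finset.mem_filter.1 hl).2.1]
  have hd := (abs_le.1 (hdev i k y)).2
  have := le_four_mul_sqrt_div (d := f (X j) - c) hN₀ (hcard.trans hsub)
    (Real.log_natCast_nonneg n) (by linarith)
  linarith

theorem IsAntitonicLSE.sub_sqrt_le (hf : IsAntitonicLSE X Y y f) (hdev : SmallDeviations F X Y)
    {i j : Fin n} {N₀ c : ℝ} (hN₀ : 0 < N₀) (hcard : N₀ ≤ (indicesBetween X j i).card)
    (hc : ∀ l, X l ≤ X i → c ≤ F (X l) y) : c - 4 * √(Real.log n / N₀) ≤ f (X j) := by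
  obtain ⟨k, hjk, hk⟩ := hf.exists_frequency_le i j
  rw [sum_indicator_sub_eq (F := F) (X := X)] at hk
  have hsub : ((indicesBetween X j i).card : ℝ) ≤ (indicesBetween X k i).card := by
    exact_mod_cast Finset.card_le_card (indicesBetween_mono hjk le_rfl)
  have hsum : (indicesBetween X k i).card * (c - f (X j))
      ≤ ∑ l ∈ indicesBetween X k i, (F (X l) y - f (X j)) := by
    rw [← nsmul_eq_mul]
    refine Finset.card_nsmul_le_sum _ _ _ fun l hl => ?_
    linarith [hc l (Finset.mem_filter.1 hl).2.2]
  have hd := (abs_le.1 (hdev k i y)).1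
  have := le_four_mul_sqrt_div (d := c - f (X j)) hN₀ (hcard.trans hsub)
    (Real.log_natCast_nonneg n) (by linarith)
  linarith

/-- Together with `IsAntitonicLSE.nonpos`, this ensures that the infima defining the quantiles of
the fit are over nonempty, respectively bounded below, sets. -/
theorem IsAntitonicLSE.one_le (hf : IsAntitonicLSE X Y y f) (hy : ∀ i, Y i ≤ y) (j : Fin n) :
    1 ≤ f (X j) := by
  obtain ⟨k, hjk, hk⟩ := hf.exists_frequency_le j j
  have hmem : j ∈ indicesBetween X k j := by simp [indicesBetween, hjk]
  have hpos : (0 : ℝ) < (indicesBetween X k j).card := by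
    exact_mod_cast Finset.card_pos.2 ⟨j, hmem⟩
  simp only [indicator_of_mem (mem_Iic.2 (hy _)), Pi.one_apply, Finset.sum_const,
    nsmul_eq_mul] at hk
  nlinarith

theorem IsAntitonicLSE.nonpos (hf : IsAntitonicLSE X Y y f) (hy : ∀ i, y < Y i) (j : Fin n) :
    f (X j) ≤ 0 := by
  obtain ⟨k, hjk, hk⟩ := hf.exists_le_frequency j j
  have hmem : j ∈ indicesBetween X j k := by simp [indicesBetween, hjk]
  have hpos : (0 : ℝ) < (indicesBetween X j k).card := by
    exact_mod_cast Finset.card_pos.2 ⟨j, hmem⟩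
  have hy' : ∀ l, (Iic y).indicator (1 : ℝ → ℝ) (Y l) = 0 := fun l =>
    indicator_of_notMem (by simpa using hy l) _
  simp only [hy', Finset.sum_const, nsmul_eq_mul] at hk
  nlinarith

/-- Deviations are controlled between design points, so the window is replaced by its extreme design
points, which enclose the same observations. -/
theorem DenseDesign.exists_indices {I : Set ℝ} {C₂ δ a b : ℝ} (h : DenseDesign X I C₂ δ)
    (hC₂ : 0 < C₂) (hn : 0 < n) (hδ : 0 < δ) (hab : b - a = δ) (hI : Icc a b ⊆ I) :
    ∃ i j, X i ∈ Icc a b ∧ X j ∈ Icc a b ∧ C₂ * (n * δ) ≤ (indicesBetween X i j).card := by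
  classical
  have hT := h (Icc a b) ordConnected_Icc hI (by rw [Real.volume_Icc, hab])
  rw [Real.volume_Icc, hab, ← ENNReal.ofReal_natCast, ← ENNReal.ofReal_mul (by positivity),
    ← ENNReal.ofReal_mul hC₂.le, ← ENNReal.ofReal_natCast,
    ENNReal.ofReal_le_ofReal_iff (by positivity)] at hT
  set D : Finset (Fin n) := Finset.univ.filter fun i => X i ∈ Icc a b with hD
  have hDcard : designCount X (Icc a b) = D.card := by
    unfold designCount
    congr!
  rw [hDcard] at hT
  have hn' : (0 : ℝ) < n := by exact_mod_cast hn
  have hne : D.Nonempty := by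
    rw [← Finset.card_pos]
    have : (0 : ℝ) < D.card := lt_of_lt_of_le (by positivity) hT
    exact_mod_cast this
  obtain ⟨i, hi, hi'⟩ := D.exists_min_image X hne
  obtain ⟨j, hj, hj'⟩ := D.exists_max_image X hne
  have hmem : ∀ k, k ∈ D ↔ X k ∈ Icc a b := fun k => by simp [hD]
  refine ⟨i, j, (hmem i).1 hi, (hmem j).1 hj, hT.trans ?_⟩
  have : D ⊆ indicesBetween X i j := fun k hk =>
    Finset.mem_filter.2 ⟨Finset.mem_univ k, hi' k hk, hj' k hk⟩
  exact_mod_cast Finset.card_le_card this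

end Deterministic

/-! ### Quantile stability and the balance of bias and noise -/

/-- Stability of quantiles: a number lying between quantiles of two functions that bracket a
distribution function up to `Δ` is close to the quantile, if the distribution function grows. -/
theorem abs_sub_le_of_quantile_bracket {G L U : ℝ → ℝ} (hG : IsDistributionFunction G)
    {β β₁ β₂ κ Δ q q' : ℝ} (hκ : 0 < κ) (hβ : 0 < β) (hΔ : 0 ≤ Δ)
    (hβ₁ : β₁ < β - Δ) (hβ₂ : β + Δ < β₂) (hβ1 : β < 1)
    (hgrow : ∀ y₁ y₂ : ℝ, y₁ < y₂ → G y₁ ∈ Ioo β₁ β₂ → Function.leftLim G y₂ ∈ Ioo β₁ β₂ →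
      κ * (y₂ - y₁) ≤ G y₂ - G y₁)
    (hq : IsQuantile G β q) (hL : ∀ y, L y ≤ G y + Δ) (hLne : ∃ y, β ≤ L y)
    (hLq : minQuantile L β ≤ q') (hU : ∀ y, G y - Δ ≤ U y) (hUbdd : BddBelow {y | β < U y})
    (hUq : q' ≤ maxQuantile U β) : |q' - q| ≤ κ⁻¹ * (2 * Δ) := by
  have hlow : ∀ y, G y < β - Δ → y ≤ q ∧ y ≤ q' := by
    intro y hy
    constructor
    · refine le_trans (le_csInf ?_ fun z hz => ?_) hq.1
      · obtain ⟨z, hz⟩ := (hG.tendsto_atTop.eventually_const_lt hβ1).exists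
        exact ⟨z, hz.le⟩
      · by_contra! hzy
        have hz' : β ≤ G z := hz
        linarith [hG.mono hzy.le]
    · refine le_trans (le_csInf hLne fun z hz => ?_) hLq
      by_contra! hzy
      have hz' : β ≤ L z := hz
      linarith [hG.mono hzy.le, hL z]
  have hhigh : ∀ y, β + Δ < G y → q ≤ y ∧ q' ≤ y := by
    intro y hy
    constructor
    · refine hq.2.trans (csInf_le ?_ (show β < G y by linarith))
      obtain ⟨a, ha⟩ := (hG.tendsto_atBot.eventually_lt_const hβ).exists
      refine ⟨a, fun z hz => ?_⟩
      by_contra! hza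
      have hz' : β < G z := hz
      linarith [hG.mono hza.le]
    · exact hUq.trans (csInf_le hUbdd (show β < U y by linarith [hU y]))
  have key : ∀ a b, (a = q ∧ b = q' ∨ a = q' ∧ b = q) → b - a ≤ κ⁻¹ * (2 * Δ) := by
    intro a b hab
    by_contra! hlt
    have hs : 0 ≤ κ⁻¹ * (2 * Δ) := by positivity
    -- Moving both ends inwards by g makes the comparisons with the quantiles strict, and still
    -- leaves a gap of κ⁻¹(2Δ) + g, over which G rises by at most 2Δ: too little for the growth
    -- condition.
    set g := (b - a - κ⁻¹ * (2 * Δ)) / 3 with hg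
    have hg0 : 0 < g := by rw [hg]; linarith
    have h1 : β - Δ ≤ G (a + g) := by
      by_contra! h
      rcases hab with ⟨rfl, rfl⟩ | ⟨rfl, rfl⟩
      · linarith [(hlow _ h).1]
      · linarith [(hlow _ h).2]
    have h2 : G (b - g) ≤ β + Δ := by
      by_contra! h
      rcases hab with ⟨rfl, rfl⟩ | ⟨rfl, rfl⟩
      · linarith [(hhigh _ h).2]
      · linarith [(hhigh _ h).1]
    have h12 : a + g < b - g := by linarith
    have h3 := hG.mono h12.le
    have h4 := hG.mono.le_leftLim h12
    have h5 := hG.mono.leftLim_le (le_refl (b - g))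
    have h6 := hgrow _ _ h12 ⟨by linarith, by linarith⟩ ⟨by linarith, by linarith⟩
    have h7 : κ * (b - g - (a + g)) ≤ 2 * Δ := by linarith
    have h8 : b - g - (a + g) ≤ κ⁻¹ * (2 * Δ) := by
      rw [inv_mul_eq_div, le_div_iff₀ hκ]; linarith
    linarith
  rw [abs_le]
  constructor
  · linarith [key q' q (Or.inr ⟨rfl, rfl⟩)]
  · exact key q q' (Or.inl ⟨rfl, rfl⟩)

/-- Half of the constant in the rate of convergence. -/
def rateConstant (C₁ C₂ C₃ : ℝ) : ℝ := C₁ * (1 + C₃) + 4 * √((C₂ * C₃)⁻¹)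

theorem rateConstant_pos {C₁ C₂ C₃ : ℝ} (hC₁ : 0 < C₁) (hC₃ : 0 < C₃) :
    0 < rateConstant C₁ C₂ C₃ := by
  unfold rateConstant; positivity

theorem rho_pos {n : ℕ} (hn : 2 ≤ n) : 0 < rho n := by
  have : (1 : ℝ) < n := by exact_mod_cast hn
  exact div_pos (Real.log_pos this) (by linarith)

theorem bandwidth_pos {C₃ : ℝ} (hC₃ : 0 < C₃) (α : ℝ) {n : ℕ} (hn : 2 ≤ n) :
    0 < bandwidth C₃ α n :=
  mul_pos hC₃ (Real.rpow_pos_of_pos (rho_pos hn) _)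

/-- Since α ≤ 1, C₃^α ≤ max(1, C₃) ≤ 1 + C₃, which keeps the constant free of α. -/
theorem bias_le {C₃ α : ℝ} (hC₃ : 0 < C₃) (hα : α ∈ Ioc (0 : ℝ) 1) {n : ℕ} (hn : 2 ≤ n) :
    bandwidth C₃ α n ^ α ≤ (1 + C₃) * rho n ^ (α / (2 * α + 1)) := by
  have hρ := rho_pos hn
  rw [bandwidth, Real.mul_rpow hC₃.le (by positivity), ← Real.rpow_mul hρ.le]
  have he : 1 / (2 * α + 1) * α = α / (2 * α + 1) := by ring
  rw [he]
  refine mul_le_mul_of_nonneg_right ?_ (by positivity)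
  rcases le_total C₃ 1 with h | h
  · linarith [Real.rpow_le_one hC₃.le h hα.1.le]
  · have := Real.rpow_le_rpow_of_exponent_le h hα.2
    rw [Real.rpow_one] at this
    linarith

/-- The bandwidth exponent is chosen for the splitting ρ = ρ^(1/(2α+1)) · (ρ^(α/(2α+1)))², which
gives the noise the same rate as the bias. -/
theorem sqrt_log_div_eq {C₂ C₃ α : ℝ} (hC₂ : 0 < C₂) (hC₃ : 0 < C₃) (hα : 0 < α) {n : ℕ}
    (hn : 2 ≤ n) :
    √(Real.log n / (C₂ * (n * bandwidth C₃ α n)))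
      = √((C₂ * C₃)⁻¹) * rho n ^ (α / (2 * α + 1)) := by
  have hρ := rho_pos hn
  have hn' : (0 : ℝ) < n := by exact_mod_cast (by omega : 0 < n)
  have h1 : rho n = rho n ^ (1 / (2 * α + 1)) * (rho n ^ (α / (2 * α + 1))) ^ 2 := by
    rw [← Real.rpow_natCast, ← Real.rpow_mul hρ.le, ← Real.rpow_add hρ]
    have : 1 / (2 * α + 1) + α / (2 * α + 1) * ((2 : ℕ) : ℝ) = 1 := by
      push_cast
      field_simp
      ring
    rw [this, Real.rpow_one]
  have h2 : Real.log n = rho n * n := by rw [rho]; field_simp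
  have h3 : Real.log n / (C₂ * (n * bandwidth C₃ α n))
      = (C₂ * C₃)⁻¹ * (rho n ^ (α / (2 * α + 1))) ^ 2 := by
    have hb : (0 : ℝ) < rho n ^ (1 / (2 * α + 1)) := Real.rpow_pos_of_pos hρ _
    rw [h2, bandwidth]
    nth_rewrite 1 [h1]
    field_simp
  rw [h3, Real.sqrt_mul (by positivity), Real.sqrt_sq (by positivity)]

/-- On the event of a dense design and small deviations, the plug-in estimator satisfies the
asserted error bound. -/
theorem IsPlugInEstimator.abs_sub_le {C₁ C₂ C₃ α β₁ β₂ κ : ℝ} (hC₁ : 0 < C₁) (hC₂ : 0 < C₂)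
    (hC₃ : 0 < C₃) (hα : α ∈ Ioc (0 : ℝ) 1) (hβ₁ : 0 ≤ β₁) (hβ₂ : β₂ ≤ 1) (hκ : 0 < κ)
    {𝒳 I : Set ℝ} (hI𝒳 : I ⊆ 𝒳) {F Q : ℝ → ℝ → ℝ}
    (hF : ∀ x ∈ 𝒳, IsDistributionFunction (F x)) (hanti : ∀ y, AntitoneOn (fun x => F x y) 𝒳)
    (hQ : ∀ x ∈ 𝒳, ∀ β ∈ Ioo (0 : ℝ) 1, IsQuantile (F x) β (Q x β))
    (hHolder : HolderCDF F I univ α C₁) (hgrow : GrowthCDF F I β₁ β₂ κ)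
    {n : ℕ} (hn : 2 ≤ n) {X Y : Fin n → ℝ} (hX : ∀ i, X i ∈ 𝒳)
    (hdense : DenseDesign X I C₂ (bandwidth C₃ α n)) (hdev : SmallDeviations F X Y)
    {Qhat : ℝ → ℝ → ℝ} (hQhat : IsPlugInEstimator 𝒳 X Y Qhat)
    {x β : ℝ} (hx : x ∈ innerSet I (bandwidth C₃ α n))
    (hβ : β ∈ Ioo (β₁ + 2 * rateConstant C₁ C₂ C₃ * rho n ^ (α / (2 * α + 1)))
      (β₂ - 2 * rateConstant C₁ C₂ C₃ * rho n ^ (α / (2 * α + 1)))) :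
    |Qhat x β - Q x β|
      ≤ κ⁻¹ * (2 * rateConstant C₁ C₂ C₃) * rho n ^ (α / (2 * α + 1)) := by
  obtain ⟨Fhat, hLSE, hplug⟩ := hQhat
  set r := rho n ^ (α / (2 * α + 1)) with hr
  set δ := bandwidth C₃ α n with hδdef
  have hδ : 0 < δ := bandwidth_pos hC₃ α hn
  have hr0 : 0 < r := Real.rpow_pos_of_pos (rho_pos hn) _
  have hn0 : (0 : ℝ) < n := by exact_mod_cast (by omega : 0 < n)
  set Δ := rateConstant C₁ C₂ C₃ * r with hΔdef
  have hΔ : 0 < Δ := mul_pos (rateConstant_pos hC₁ hC₃) hr0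
  have hΔ' : Δ = C₁ * ((1 + C₃) * r) + 4 * √(Real.log n / (C₂ * (n * δ))) := by
    rw [hΔdef, rateConstant, hδdef, sqrt_log_div_eq hC₂ hC₃ hα.1 hn]; ring
  have hN₀ : 0 < C₂ * (n * δ) := by positivity
  have hI : Icc (x - δ) (x + δ) ⊆ I := hx
  have hxI : x ∈ I := hI ⟨by linarith, by linarith⟩
  have hβ' : β₁ + 2 * Δ < β ∧ β < β₂ - 2 * Δ := by
    constructor
    · linarith [hβ.1]
    · linarith [hβ.2]
  have hβ01 : β ∈ Ioo (0 : ℝ) 1 := ⟨by linarith, by linarith⟩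
  have hbias : ∀ w, w ∈ Icc (x - δ) (x + δ) → ∀ y, |F w y - F x y| ≤ C₁ * ((1 + C₃) * r) := by
    intro w hw y
    refine (hHolder w (hI hw) x hxI y (mem_univ y)).trans (mul_le_mul_of_nonneg_left ?_ hC₁.le)
    refine le_trans (Real.rpow_le_rpow (abs_nonneg _) ?_ hα.1.le) (bias_le hC₃ hα hn)
    exact abs_le.2 ⟨by linarith [hw.1], by linarith [hw.2]⟩
  -- The left window bounds the fit at X j ≤ x from above, hence the estimator at x from below; the
  -- right window does the reverse.
  obtain ⟨i, j, hi, hj, hcard⟩ := hdense.exists_indices (a := x - δ) (b := x) hC₂ (by omega) hδ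
    (by ring) ((Icc_subset_Icc_right (by linarith)).trans hI)
  obtain ⟨j', i', hj', hi', hcard'⟩ := hdense.exists_indices (a := x) (b := x + δ) hC₂
    (by omega) hδ (by ring) ((Icc_subset_Icc_left (by linarith)).trans hI)
  obtain ⟨hmono, hquant⟩ := hplug β hβ01
  have hquantj := hquant _ (mem_designPoints j)
  have hquantj' := hquant _ (mem_designPoints j')
  have main := abs_sub_le_of_quantile_bracket (L := Fhat (X j)) (U := Fhat (X j')) (q' := Qhat x β)
    (hF x (hI𝒳 hxI)) hκ hβ01.1 hΔ.le (by linarith) (by linarith) hβ01.2 (hgrow x hxI)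
    (hQ x (hI𝒳 hxI) β hβ01) ?_ ?_ (hquantj.1.trans (hmono (hX j) (hI𝒳 hxI) hj.2)) ?_ ?_
    ((hmono (hI𝒳 hxI) (hX j') hj'.1).trans hquantj'.2)
  · exact main.trans_eq (by rw [hΔdef]; ring)
  · intro y
    have h1 := (hLSE y).le_add_sqrt hdev hN₀ hcard (c := F (X i) y)
      fun l hl => hanti y (hX i) (hX l) hl
    have h2 := (abs_le.1 (hbias (X i) ⟨hi.1, by linarith [hi.2]⟩ y)).2
    linarith
  · obtain ⟨M, hM⟩ := (Set.finite_range Y).bddAbove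
    exact ⟨M, hβ01.2.le.trans ((hLSE M).one_le (fun k => hM ⟨k, rfl⟩) j)⟩
  · intro y
    have h1 := (hLSE y).sub_sqrt_le hdev hN₀ hcard' (c := F (X i') y)
      fun l hl => hanti y (hX l) (hX i') hl
    have h2 := (abs_le.1 (hbias (X i') ⟨by linarith [hi'.1], hi'.2⟩ y)).1
    linarith
  · obtain ⟨M, hM⟩ := (Set.finite_range Y).bddBelow
    refine ⟨M, fun y hy => ?_⟩
    by_contra! hyM
    have h1 := (hLSE y).nonpos (fun k => hyM.trans_le (hM ⟨k, rfl⟩)) j'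
    have hy' : β < Fhat (X j') y := hy
    linarith [hβ01.1]

end

/-! ### The main theorem -/

theorem theorem2 (C₁ C₂ C₃ : ℝ) (hC₁ : 0 < C₁) (hC₂ : 0 < C₂) (hC₃ : 0 < C₃) :
    ∃ C : ℝ, 0 < C ∧
      ∀ (α β₁ β₂ κ : ℝ), α ∈ Ioc (0 : ℝ) 1 → 0 ≤ β₁ → β₁ < β₂ → β₂ ≤ 1 → 0 < κ →
      ∀ (𝒳 I : Set ℝ), 𝒳.OrdConnected → I.OrdConnected → I ⊆ 𝒳 →
      ∀ (F Q : ℝ → ℝ → ℝ),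
        (∀ x ∈ 𝒳, IsDistributionFunction (F x)) →
        (∀ y, AntitoneOn (fun x => F x y) 𝒳) →
        (∀ x ∈ 𝒳, ∀ β ∈ Ioo (0 : ℝ) 1, IsQuantile (F x) β (Q x β)) →
      ∀ (Ω : ℕ → Type*) [∀ n, MeasurableSpace (Ω n)]
        (μ : ∀ n, Measure (Ω n)) [∀ n, IsProbabilityMeasure (μ n)]
        (X Y : ∀ n, Fin n → Ω n → ℝ),
        (∀ n, 2 ≤ n → IsRegressionSample (μ n) 𝒳 F (X n) (Y n)) →
        HolderCDF F I univ α C₁ →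
        -- the probability that the design is dense tends to one
        Tendsto (fun n => μ n {ω | DenseDesign (fun i => X n i ω) I C₂ (bandwidth C₃ α n)}ᶜ)
          atTop (𝓝 0) →
        GrowthCDF F I β₁ β₂ κ →
      ∀ Qhat : ∀ n, Ω n → ℝ → ℝ → ℝ,
        (∀ n, 2 ≤ n → ∀ ω,
          IsPlugInEstimator 𝒳 (fun i => X n i ω) (fun i => Y n i ω) (Qhat n ω)) →
        Tendsto (fun n => μ n {ω |
            ENNReal.ofReal (κ⁻¹ * C * rho n ^ (α / (2 * α + 1))) <
              ⨆ x ∈ innerSet I (bandwidth C₃ α n),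
              ⨆ β ∈ Ioo (β₁ + C * rho n ^ (α / (2 * α + 1)))
                (β₂ - C * rho n ^ (α / (2 * α + 1))),
                ENNReal.ofReal |Qhat n ω x β - Q x β|})
          atTop (𝓝 0) := by
  refine ⟨2 * rateConstant C₁ C₂ C₃, mul_pos two_pos (rateConstant_pos hC₁ hC₃), ?_⟩
  intro α β₁ β₂ κ hα hβ₁ _ hβ₂ hκ 𝒳 I _ _ hI𝒳 F Q hF hanti hQ Ω _ μ _ X Y hsample hHolder hdense
    hgrow Qhat hQhat
  have hlim : Tendsto (fun n : ℕ => μ n {ω | DenseDesign (fun i => X n i ω) I C₂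
      (bandwidth C₃ α n)}ᶜ + ENNReal.ofReal (8 / n)) atTop (𝓝 0) := by
    have h := ENNReal.tendsto_ofReal (tendsto_const_div_atTop_nhds_zero_nat (8 : ℝ))
    rw [ENNReal.ofReal_zero] at h
    simpa using hdense.add h
  refine tendsto_of_tendsto_of_tendsto_of_le_of_le' tendsto_const_nhds hlim
    (Eventually.of_forall fun _ => zero_le) ?_
  filter_upwards [eventually_ge_atTop 2] with n hn
  refine le_trans ?_ (add_le_add le_rfl
    ((hsample n hn).measure_exists_lt_abs_centredCount_le hn hF hanti))
  -- Only monotonicity and subadditivity are used, so neither the supremum event nor the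
  -- dense-design event has to be measurable.
  refine (measure_mono fun ω hω => ?_).trans (measure_union_le _ _)
  by_contra hgood
  simp only [mem_union, mem_compl_iff, mem_ofPred_eq, not_or, not_not, not_exists, not_lt]
    at hgood
  rw [mem_ofPred_eq] at hω
  refine absurd hω (not_lt.2 ?_)
  refine iSup₂_le fun x hx => iSup₂_le fun β hβ => ENNReal.ofReal_le_ofReal ?_
  exact (hQhat n hn ω).abs_sub_le hC₁ hC₂ hC₃ hα hβ₁ hβ₂ hκ hI𝒳 hF hanti hQ hHolder hgrow hn
    (fun i => (hsample n hn).mem_X i ω) hgood.1 hgood.2 hx hβ
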